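/- **Terms.** Terms are built from the singleton $1$ by concatenation $s\,^\wedge t$ and, for every $n\ge 1$, by the $\mathbb{Q}_n$-shuffle $\mathbb{Q}_n(t_0,\dots,t_{n-1})$. Two terms are regarded as the same, written $S=T$, if one is obtained from the other by rebracketing concatenations and permuting the arguments of shuffles, at any level of the term. **Represented orders.** A term $t$ represents a linear order $L_t$: $L_1$ is a one-point order; $L_{s^\wedge t}$ is $L_s$ followed by $L_t$; and $L_{\mathbb{Q}_n(t_0,\dots,t_{n-1})}$ is obtained from the generic $n$-coloured linear order (the countable dense linear order without endpoints, coloured with $n$ colours each of which occurs between any two points) by replacing every point of colour $i$ by a copy of $L_{t_i}$. **Normal form.** Being in normal form is defined by recursion on terms. In what follows, $\emptyset$ in a concatenation means that this piece is omitted. 1. Every term without shuffles (equivalently, every term representing a finite order) is in normal form. 2. A term $\mathbb{Q}_m(s_0,\dots,s_{m-1})$ is in normal form if all $s_i$ are in normal form, no two of the arguments $s_i$, $s_j$ with $i\neq j$ are the same term, and there is no shuffle $\mathbb{Q}_n(t_0,\dots,t_{n-1})$ such that every $s_i$ is either one of the $t_j$ or of the form $\tau_0\,^\wedge\,\mathbb{Q}_n(t_0,\dots,t_{n-1})\,^\wedge\,\tau_1$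 with $\tau_0,\tau_1\in\{\emptyset,t_0,\dots,t_{n-1}\}$ (where $\tau_0,\tau_1$ may depend on $i$), and at least one $s_i$ is of the latter form. 3. A concatenation $t_0\,^\wedge\cdots^\wedge\,t_{k-1}$ is in normal form if all $t_i$ are in normal form and no consecutive part of it, bracketed in any way, has the form $\mathbb{Q}_n(u_0,\dots,u_{n-1})\,^\wedge\,\tau\,^\wedge\,\mathbb{Q}_n(u_0,\dots,u_{n-1})$ with $\tau\in\{\emptyset,u_0,\dots,u_{n-1}\}$. **Proposition.** Let $S$ and $T$ be terms in normal form. If $L_S\cong L_T$, then $S=T$; that is, $S$ and $T$ are the same term up to rebracketing concatenations and permuting the arguments of shuffles. -/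

import Mathlib

namespace CatOrder

/-- Terms: the singleton `1`, concatenation, and the shuffle of a nonempty finite family.
`shuffle t` with `t : Fin (n + 1) → Term` is the `ℚ_{n+1}`-shuffle of `t 0, …, t n`. -/
inductive Term : Type
  | one : Term
  | cat : Term → Term → Term
  | shuffle : {n : ℕ} → (Fin (n + 1) → Term) → Term

/-- Identity of terms: brackets in concatenations are ignored, and so is the order of the
arguments of a shuffle (at every level of the term).  This is the least congruence that contains
associativity of concatenation and permutation of the arguments of a shuffle. -/
inductive Term.Same : Term → Term → Prop
  | refl (s : Term) : Same s s
  | symm {s t : Term} : Same s t → Same t s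
  | trans {s t u : Term} : Same s t → Same t u → Same s u
  | assoc (s t u : Term) : Same (.cat (.cat s t) u) (.cat s (.cat t u))
  | cat_congr {s s' t t' : Term} : Same s s' → Same t t' → Same (.cat s t) (.cat s' t')
  | shuffle_congr {n : ℕ} {s t : Fin (n + 1) → Term} :
      (∀ i, Same (s i) (t i)) → Same (.shuffle s) (.shuffle t)
  | shuffle_perm {n : ℕ} (s : Fin (n + 1) → Term) (e : Equiv.Perm (Fin (n + 1))) :
      Same (.shuffle fun i => s (e i)) (.shuffle s)

/-! ### The linear order represented by a term -/

/-- `c` makes `Q` the generic linear order coloured by `C`: a countable nonempty linear order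
without endpoints in which every colour occurs between any two points. -/
structure IsGenericColouring {Q C : Type} [LinearOrder Q] (c : Q → C) : Prop where
  countable : Countable Q
  nonempty : Nonempty Q
  noMin : NoMinOrder Q
  noMax : NoMaxOrder Q
  interdense : ∀ x y : Q, x < y → ∀ i : C, ∃ z, x < z ∧ z < y ∧ c z = i

/-- A concrete generic colouring of `ℚ` by `n + 1` colours
(see `colour_isGenericColouring`): the 2-adic valuation modulo `n + 1`. -/
def colour (n : ℕ) (q : ℚ) : Fin (n + 1) := Fin.ofNat (n + 1) (padicValRat 2 q).toNat

theorem colour_isGenericColouring (n : ℕ) : IsGenericColouring (colour n) where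
  countable := inferInstance
  nonempty := inferInstance
  noMin := inferInstance
  noMax := inferInstance
  interdense := by
    intro x y hxy i
    have hd : (0 : ℚ) < y - x := sub_pos.mpr hxy
    have hp : (0 : ℚ) < 2 ^ (i : ℕ) := by positivity
    obtain ⟨k, hk⟩ := pow_unbounded_of_one_lt (2 * 2 ^ (i : ℕ) / (y - x)) (by norm_num : (1 : ℚ) < 3)
    have h3 : (0 : ℚ) < 3 ^ k := by positivity
    rw [div_lt_iff₀ hd] at hk
    set m : ℤ := ⌊x * 3 ^ k / (2 * 2 ^ (i : ℕ)) + 1 / 2⌋ with hm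
    have h1 : (m : ℚ) ≤ x * 3 ^ k / (2 * 2 ^ (i : ℕ)) + 1 / 2 := Int.floor_le _
    have h2 : x * 3 ^ k / (2 * 2 ^ (i : ℕ)) + 1 / 2 < m + 1 := Int.lt_floor_add_one _
    have e : x * 3 ^ k / (2 * 2 ^ (i : ℕ)) * (2 * 2 ^ (i : ℕ)) = x * 3 ^ k := by field_simp
    have hodd : ((2 * m + 1 : ℤ) : ℚ) ≠ 0 := by
      have : (2 * m + 1 : ℤ) ≠ 0 := by omega
      exact_mod_cast this
    refine ⟨((2 * m + 1 : ℤ) : ℚ) * 2 ^ (i : ℕ) / 3 ^ k, ?_, ?_, ?_⟩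
    · rw [lt_div_iff₀ h3]; push_cast; nlinarith
    · rw [div_lt_iff₀ h3]; push_cast; nlinarith
    · have v1 : padicValRat 2 ((2 * m + 1 : ℤ) : ℚ) = 0 := by
        rw [padicValRat.of_int]
        have : padicValInt 2 (2 * m + 1) = 0 :=
          padicValInt.eq_zero_of_not_dvd (by omega)
        simp [this]
      have v2 : padicValRat 2 ((2 : ℚ) ^ (i : ℕ)) = i := by
        have h := padicValRat.pow (p := 2) (q := (2 : ℚ)) (k := (i : ℕ))
        have h' : padicValRat 2 (2 : ℚ) = 1 := by
          simpa using padicValRat.self (p := 2) (by norm_num)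
        rw [h, h']; simp
      have v3 : padicValRat 2 ((3 : ℚ) ^ k) = 0 := by
        have h := padicValRat.pow (p := 2) (q := (3 : ℚ)) (k := k)
        have h' : padicValRat 2 (3 : ℚ) = 0 := by
          have := padicValRat.of_nat (p := 2) (n := 3)
          rw [padicValNat.eq_zero_of_not_dvd (by norm_num)] at this
          exact_mod_cast this
        rw [h, h']; simp
      have v : padicValRat 2 (((2 * m + 1 : ℤ) : ℚ) * 2 ^ (i : ℕ) / 3 ^ k) = i := by
        rw [padicValRat.div (mul_ne_zero hodd hp.ne') h3.ne', padicValRat.mul hodd hp.ne',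
          v1, v2, v3]
        simp
      rw [colour, v]
      simp

/-- The underlying set of the linear order `L_t`: the concatenation is the ordered (lexicographic)
sum, and in the shuffle every point `q` of the generic coloured order is replaced by a copy of
the argument that belongs to the colour of `q`. -/
def Term.L : Term → Type
  | .one => Unit
  | .cat s t => L s ⊕ₗ L t
  | .shuffle (n := n) t => Σₗ q : ℚ, L (t (colour n q))

/-- The order on `L_t`. -/
@[reducible] noncomputable def Term.linearOrderL : (t : Term) → LinearOrder t.L
  | .one => (inferInstance : LinearOrder Unit)
  | .cat s t => @Sum.Lex.linearOrder s.L t.L (linearOrderL s) (linearOrderL t)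
  | .shuffle (n := n) t =>
      @Sigma.Lex.linearOrder ℚ (fun q => (t (colour n q)).L) _
        (fun q => linearOrderL (t (colour n q)))

noncomputable instance (t : Term) : LinearOrder t.L := t.linearOrderL

/-! ### Normal form -/

/-- The term `a ^ s ^ b`, where `none` stands for the empty set. -/
def Term.surround : Option Term → Term → Option Term → Term
  | none, s, none => s
  | some a, s, none => .cat a s
  | none, s, some b => .cat s b
  | some a, s, some b => .cat (.cat a s) b

/-- `s` shuffles some term twice. -/
def HasRepetition {n : ℕ} (s : Fin (n + 1) → Term) : Prop :=
  ∃ i j, i ≠ j ∧ (s i).Same (s j)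

/-- `r` is `τ₀ ^ ℚₙ(t) ^ τ₁`, where each of `τ₀`, `τ₁` is empty or one of the terms of `t`. -/
def IsNested {n : ℕ} (t : Fin (n + 1) → Term) (r : Term) : Prop :=
  ∃ τ₀ τ₁ : Option (Fin (n + 1)),
    r.Same (Term.surround (τ₀.map t) (.shuffle t) (τ₁.map t))

/-- For some shuffle `ℚₙ(t)`, every term of `s` is a term of `t` or has the form
`τ₀ ^ ℚₙ(t) ^ τ₁`, and at least one of them has this second form. -/
def HasNesting {m : ℕ} (s : Fin (m + 1) → Term) : Prop :=
  ∃ (n : ℕ) (t : Fin (n + 1) → Term),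
    (∀ i, (∃ j, (s i).Same (t j)) ∨ IsNested t (s i)) ∧ ∃ i, IsNested t (s i)

/-- Some consecutive part of the concatenation `r` has the form `ℚₙ(t) ^ τ ^ ℚₙ(t)`,
where `τ` is empty or one of the terms of `t`. -/
def HasAbsorption (r : Term) : Prop :=
  ∃ (n : ℕ) (t : Fin (n + 1) → Term) (τ : Option (Fin (n + 1))) (a b : Option Term),
    r.Same (Term.surround a
      (.cat (Term.surround none (.shuffle t) (τ.map t)) (.shuffle t)) b)

/-- Terms in normal form.  (Terms without shuffles, which are the ones that represent finite
orders, always are.) -/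
def Term.IsNormalForm : Term → Prop
  | .one => True
  | .cat s t => IsNormalForm s ∧ IsNormalForm t ∧ ¬ HasAbsorption (.cat s t)
  | .shuffle s => (∀ i, IsNormalForm (s i)) ∧ ¬ HasRepetition s ∧ ¬ HasNesting s

end CatOrder

namespace CatOrder

open Set

/-! ### The monoid of terms up to identity -/

/-! The term is recovered from its order by collapsing shuffles from the inside out. At each stage
some shuffles, those with class in `𝒜`, count as atoms: a copy of such a shuffle is a single point,
coloured by its class. Suppose that `S` and `T` describe the same coloured set `I`. If `S` has no
shuffle outside the atoms, then `I` is finite, and the product of its colours is the class of every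
term that describes it (`Rep.cls_eq_of_finite`), so `S` and `T` agree.

Otherwise `S` contains an innermost shuffle `ℚ(u)`, whose arguments are words of atoms. Its convex
copies in `I` depend on `I`, the colouring and `u` only, not on a term for `I`. Normality keeps a
copy from crossing the pieces into which a term divides `I`: crossing a concatenation would exhibit
a part `ℚ(u) ^ τ ^ ℚ(u)` (`part_subset_of_cat`), and crossing the blocks of a shuffle would produce
a nesting, unless that shuffle is `ℚ(u)` itself (`part_subset_of_shuffle`). Both lemmas need that a
copy with a finite remainder on one side is written out in the term. They assume this for the
immediate subterms, and `showsEnds` uses them to climb to the whole term.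

Hence, when every maximal copy is collapsed to a point of colour `ℚ(u)`, both terms describe the
resulting set, with `ℚ(u)` as a new atom (`Rep.collapse`). Fewer shuffles of `S` remain, and
induction finishes the proof. -/

instance Term.setoid : Setoid Term where
  r := Term.Same
  iseqv := ⟨.refl, .symm, .trans⟩

instance : Semigroup (Quotient Term.setoid) where
  mul := Quotient.map₂ Term.cat fun _ _ h _ _ h' => .cat_congr h h'
  mul_assoc := by
    rintro ⟨s⟩ ⟨t⟩ ⟨u⟩
    exact Quotient.sound (.assoc s t u)

/-- Terms up to identity together with the empty term, a monoid under concatenation. -/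
abbrev Term.Class : Type := WithOne (Quotient Term.setoid)

/-- The class of a term. -/
def Term.cls (t : Term) : Term.Class := ((⟦t⟧ : Quotient Term.setoid) : WithOne _)

/-- The class of a term or of the empty term. -/
def optCls (o : Option Term) : Term.Class := o.elim 1 Term.cls

theorem Term.cls_eq {s t : Term} : s.cls = t.cls ↔ s.Same t := by
  unfold Term.cls
  rw [WithOne.coe_inj]
  exact Quotient.eq

theorem Term.cls_cat (s t : Term) : (Term.cat s t).cls = s.cls * t.cls := rfl

theorem cls_surround (a : Option Term) (s : Term) (b : Option Term) :
    (Term.surround a s b).cls = optCls a * s.cls * optCls b := by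
  cases a <;> cases b <;> simp [Term.surround, optCls, Term.cls_cat]

theorem exists_optCls (x : Term.Class) : ∃ o, optCls o = x := by
  refine WithOne.cases_on x ⟨none, rfl⟩ fun a => ?_
  obtain ⟨t, rfl⟩ := Quotient.exists_rep a
  exact ⟨some t, rfl⟩

/-- Without repetitions, matching equal arguments is a bijection, so the shuffles have the same
arity and differ by a permutation. -/
theorem cls_shuffle_congr {m n : ℕ} {s : Fin (m + 1) → Term} {u : Fin (n + 1) → Term}
    (hs : ¬ HasRepetition s) (hu : ¬ HasRepetition u)
    (h₁ : ∀ i, ∃ k, (s i).cls = (u k).cls) (h₂ : ∀ k, ∃ i, (s i).cls = (u k).cls) :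
    (Term.shuffle s).cls = (Term.shuffle u).cls := by
  choose f hf using h₁
  have inj : Function.Injective f := by
    intro i j hij
    by_contra hne
    exact hs ⟨i, j, hne, Term.cls_eq.1 (by rw [hf, hf, hij])⟩
  have surj : Function.Surjective f := by
    intro k
    obtain ⟨i, hi⟩ := h₂ k
    refine ⟨i, ?_⟩
    by_contra hne
    exact hu ⟨f i, k, hne, Term.cls_eq.1 (by rw [← hf, hi])⟩
  have hmn : m = n := by simpa using Fintype.card_of_bijective ⟨inj, surj⟩
  subst hmn
  rw [Term.cls_eq]
  refine .trans (.shuffle_congr (t := fun i => u (f i)) fun i => Term.cls_eq.1 (hf i)) ?_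
  exact .shuffle_perm u (Equiv.ofBijective f ⟨inj, surj⟩)

/-! ### Convex parts of a linear order -/

section Order

variable {X : Type} [LinearOrder X]

/-- Every point of `J` lies below every point of `K`. -/
def Before (J K : Set X) : Prop := ∀ x ∈ J, ∀ y ∈ K, x < y

/-- `D` is a convex part of `I`. -/
structure ConvexIn (I D : Set X) : Prop where
  subset : D ⊆ I
  mem : ∀ x ∈ D, ∀ z ∈ D, ∀ y ∈ I, x < y → y < z → y ∈ D

theorem ConvexIn.trans {I J D : Set X} (h : ConvexIn I J) (h' : ConvexIn J D) : ConvexIn I D where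
  subset := h'.subset.trans h.subset
  mem x hx z hz y hy hxy hyz :=
    h'.mem x hx z hz y (h.mem x (h'.subset hx) z (h'.subset hz) y hy hxy hyz) hxy hyz

theorem ConvexIn.of_subset {I J D : Set X} (h : ConvexIn I D) (hJ : J ⊆ I) (hD : D ⊆ J) :
    ConvexIn J D where
  subset := hD
  mem x hx z hz y hy := h.mem x hx z hz y (hJ hy)

theorem Before.mono {J K J' K' : Set X} (h : Before J K) (hJ : J' ⊆ J) (hK : K' ⊆ K) :
    Before J' K' := fun x hx y hy => h x (hJ hx) y (hK hy)

theorem Before.convexIn_left {J K : Set X} (h : Before J K) : ConvexIn (J ∪ K) J where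
  subset := subset_union_left
  mem := by
    rintro x hx z hz y (hy | hy) hxy hyz
    · exact hy
    · exact absurd (h z hz y hy) hyz.le.not_gt

theorem Before.convexIn_right {J K : Set X} (h : Before J K) : ConvexIn (J ∪ K) K where
  subset := subset_union_right
  mem := by
    rintro x hx z hz y (hy | hy) hxy hyz
    · exact absurd (h y hy x hx) hxy.le.not_gt
    · exact hy

open Classical in
/-- The product of the colours of the points of a finite set, in increasing order. -/
noncomputable def wordProd {M : Type} [Monoid M] (col : X → M) (I : Set X) : M :=
  if h : I.Finite then ((h.toFinset.sort (· ≤ ·)).map col).prod else 1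

variable {M : Type} [Monoid M] (col : X → M)

theorem wordProd_empty : wordProd col ∅ = 1 := by
  simp [wordProd]

theorem wordProd_singleton (x : X) : wordProd col {x} = col x := by
  simp [wordProd]

theorem wordProd_union {J K : Set X} (hJ : J.Finite) (hK : K.Finite) (h : Before J K) :
    wordProd col (J ∪ K) = wordProd col J * wordProd col K := by
  rw [wordProd, wordProd, wordProd, dif_pos (hJ.union hK), dif_pos hJ, dif_pos hK,
    ← List.prod_append, ← List.map_append]
  congr 2
  refine List.Perm.eq_of_pairwise (le := (· ≤ ·)) ?_ (Finset.pairwise_sort _ _) ?_ ?_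
  · exact fun a b _ _ => le_antisymm
  · rw [List.pairwise_append]
    refine ⟨Finset.pairwise_sort _ _, Finset.pairwise_sort _ _, fun a ha b hb => ?_⟩
    exact (h a (by simpa using ha) b (by simpa using hb)).le
  · rw [List.perm_ext_iff_of_nodup (Finset.sort_nodup _ _)]
    · simp
    · rw [List.nodup_append]
      refine ⟨Finset.sort_nodup _ _, Finset.sort_nodup _ _, fun a ha b hb => ?_⟩
      exact (h a (by simpa using ha) b (by simpa using hb)).ne

/-! ### Shuffles inside a linear order -/

/-- `I` is the union of the convex blocks `B i`, arranged as a generic coloured order, where a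
block of colour `k` has the property `P k`. -/
structure Blocks {κ ι : Type} [LinearOrder ι] (P : κ → Set X → Prop) (c : ι → κ) (B : ι → Set X)
    (I : Set X) : Prop where
  nonempty : Nonempty ι
  noMin : ∀ i : ι, ∃ j, j < i
  noMax : ∀ i : ι, ∃ j, i < j
  dense : ∀ i j : ι, i < j → ∀ k, ∃ l, i < l ∧ l < j ∧ c l = k
  before : ∀ i j : ι, i < j → Before (B i) (B j)
  eq : I = ⋃ i, B i
  prop : ∀ i, P (c i) (B i)

/-- `I` is a shuffle of sets with the properties `P k`. -/
def IsShuffle {κ : Type} (P : κ → Set X → Prop) (I : Set X) : Prop :=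
  ∃ (ι : Type) (_ : LinearOrder ι) (c : ι → κ) (B : ι → Set X), Blocks P c B I

section Blocks

variable {κ ι : Type} [LinearOrder ι] {P : κ → Set X → Prop} {c : ι → κ} {B : ι → Set X}
  {I : Set X}

theorem Blocks.subset (h : Blocks P c B I) (i : ι) : B i ⊆ I := by
  rw [h.eq]; exact subset_iUnion B i

theorem Blocks.exists_mem (h : Blocks P c B I) {x : X} (hx : x ∈ I) : ∃ i, x ∈ B i := by
  rw [h.eq] at hx; exact mem_iUnion.1 hx

theorem Blocks.le_of_le (h : Blocks P c B I) {i j : ι} {x y : X} (hx : x ∈ B i) (hy : y ∈ B j)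
    (hxy : x ≤ y) : i ≤ j := by
  by_contra hij
  exact absurd (h.before j i (not_le.1 hij) y hy x hx) hxy.not_gt

theorem Blocks.index_unique (h : Blocks P c B I) {i j : ι} {x : X} (hx : x ∈ B i) (hy : x ∈ B j) :
    i = j :=
  le_antisymm (h.le_of_le hx hy le_rfl) (h.le_of_le hy hx le_rfl)

theorem Blocks.convexIn (h : Blocks P c B I) (i : ι) : ConvexIn I (B i) where
  subset := h.subset i
  mem x hx z hz y hy hxy hyz := by
    obtain ⟨j, hj⟩ := h.exists_mem hy
    have : i = j := le_antisymm (h.le_of_le hx hj hxy.le) (h.le_of_le hj hz hyz.le)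
    exact this ▸ hj

theorem Blocks.denselyOrdered (h : Blocks P c B I) : DenselyOrdered ι where
  dense i j hij := by
    obtain ⟨l, h₁, h₂, -⟩ := h.dense i j hij (c i)
    exact ⟨l, h₁, h₂⟩

theorem Blocks.restrict (h : Blocks P c B I) {S : Set ι} (hne : S.Nonempty) (hS : S.OrdConnected)
    (hmin : ∀ i ∈ S, ∃ j ∈ S, j < i) (hmax : ∀ i ∈ S, ∃ j ∈ S, i < j) :
    IsShuffle P (⋃ i ∈ S, B i) := by
  refine ⟨S, inferInstance, fun i => c i, fun i => B i, hne.to_subtype, ?_, ?_, ?_, ?_, ?_, ?_⟩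
  · rintro ⟨i, hi⟩
    obtain ⟨j, hj, hji⟩ := hmin i hi
    exact ⟨⟨j, hj⟩, hji⟩
  · rintro ⟨i, hi⟩
    obtain ⟨j, hj, hji⟩ := hmax i hi
    exact ⟨⟨j, hj⟩, hji⟩
  · rintro ⟨i, hi⟩ ⟨j, hj⟩ hij k
    obtain ⟨l, h₁, h₂, h₃⟩ := h.dense i j hij k
    exact ⟨⟨l, hS.out hi hj ⟨h₁.le, h₂.le⟩⟩, h₁, h₂, h₃⟩
  · rintro ⟨i, hi⟩ ⟨j, hj⟩ hij
    exact h.before i j hij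
  · rw [biUnion_eq_iUnion]
  · exact fun i => h.prop i

/-- A finite convex part of a shuffle lies in one block. -/
theorem Blocks.exists_subset_of_finite (h : Blocks P c B I) (hne : ∀ i, (B i).Nonempty)
    {F : Set X} (hF : F.Finite) (hFne : F.Nonempty) (hc : ConvexIn I F) : ∃ i, F ⊆ B i := by
  have key : ∀ i j x y, x ∈ F → y ∈ F → x ∈ B i → y ∈ B j → ¬ i < j := by
    intro i j x y hx hy hxi hyj hij
    have := h.denselyOrdered
    refine Set.Ioo_infinite hij ?_
    choose p hp using hne
    have hp' : ∀ l ∈ Ioo i j, p l ∈ F := fun l hl =>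
      hc.mem x hx y hy (p l) (h.subset l (hp l)) (h.before i l hl.1 x hxi _ (hp l))
        (h.before l j hl.2 _ (hp l) y hyj)
    refine Set.Finite.of_finite_image (f := p) (hF.subset (image_subset_iff.2 hp')) ?_
    intro a _ b _ hab
    exact h.index_unique (hp a) (hab ▸ hp b)
  obtain ⟨x, hx⟩ := hFne
  obtain ⟨i, hi⟩ := h.exists_mem (hc.subset hx)
  refine ⟨i, fun y hy => ?_⟩
  obtain ⟨j, hj⟩ := h.exists_mem (hc.subset hy)
  rcases lt_trichotomy i j with hij | rfl | hij
  · exact absurd hij (key i j x y hx hy hi hj)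
  · exact hj
  · exact absurd hij (key j i y x hy hx hj hi)

theorem Blocks.exists_lt (h : Blocks P c B I) (hne : ∀ i, (B i).Nonempty) {x : X} (hx : x ∈ I) :
    ∃ y ∈ I, y < x := by
  obtain ⟨i, hi⟩ := h.exists_mem hx
  obtain ⟨j, hj⟩ := h.noMin i
  obtain ⟨y, hy⟩ := hne j
  exact ⟨y, h.subset j hy, h.before j i hj y hy x hi⟩

theorem Blocks.exists_gt (h : Blocks P c B I) (hne : ∀ i, (B i).Nonempty) {x : X} (hx : x ∈ I) :
    ∃ y ∈ I, x < y := by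
  obtain ⟨i, hi⟩ := h.exists_mem hx
  obtain ⟨j, hj⟩ := h.noMax i
  obtain ⟨y, hy⟩ := hne j
  exact ⟨y, h.subset j hy, h.before i j hj x hi y hy⟩

/-- A cut of a shuffle splits at most one block. -/
theorem Blocks.cut (h : Blocks P c B I) (hne : ∀ i, (B i).Nonempty) {J K : Set X}
    (hI : I = J ∪ K) (hJK : Before J K) (hJ : J.Nonempty) (hK : K.Nonempty) :
    ∃ A Q Q' A' : Set X, J = A ∪ Q ∧ Before A Q ∧ K = Q' ∪ A' ∧ Before Q' A' ∧
      IsShuffle P A ∧ IsShuffle P A' ∧ (Q ∪ Q' = ∅ ∨ ∃ i, Q ∪ Q' = B i) := by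
  have hsub : ∀ i, B i ⊆ J ∪ K := fun i => hI ▸ h.subset i
  -- Such a `b` is a block at the cut: it is split, or is the last block of `J` or the first of `K`.
  -- Without one, the cut falls into a gap and both sides are already shuffles.
  by_cases hb : ∃ b, (∀ i < b, B i ⊆ J) ∧ ∀ i > b, B i ⊆ K
  · obtain ⟨b, hbJ, hbK⟩ := hb
    refine ⟨⋃ i ∈ Iio b, B i, B b ∩ J, B b ∩ K, ⋃ i ∈ Ioi b, B i, ?_, ?_, ?_, ?_, ?_, ?_, ?_⟩
    · apply Subset.antisymm
      · intro x hx
        obtain ⟨i, hi⟩ := h.exists_mem (hI ▸ Or.inl hx : x ∈ I)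
        rcases lt_trichotomy i b with hib | rfl | hib
        · exact Or.inl (mem_biUnion (show i ∈ Iio b from hib) hi)
        · exact Or.inr ⟨hi, hx⟩
        · exact absurd (hJK x hx x (hbK i hib hi)) (lt_irrefl _)
      · exact union_subset (iUnion₂_subset hbJ) inter_subset_right
    · intro x hx y hy
      obtain ⟨i, hi, hxi⟩ := mem_iUnion₂.1 hx
      exact h.before i b hi x hxi y hy.1
    · apply Subset.antisymm
      · intro x hx
        obtain ⟨i, hi⟩ := h.exists_mem (hI ▸ Or.inr hx : x ∈ I)
        rcases lt_trichotomy i b with hib | rfl | hib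
        · exact absurd (hJK x (hbJ i hib hi) x hx) (lt_irrefl _)
        · exact Or.inl ⟨hi, hx⟩
        · exact Or.inr (mem_biUnion (show i ∈ Ioi b from hib) hi)
      · exact union_subset inter_subset_right (iUnion₂_subset hbK)
    · intro x hx y hy
      obtain ⟨i, hi, hyi⟩ := mem_iUnion₂.1 hy
      exact h.before b i hi x hx.1 y hyi
    · have := h.denselyOrdered
      refine h.restrict (h.noMin b) ordConnected_Iio ?_ ?_
      · intro i hi
        obtain ⟨j, hj⟩ := h.noMin i
        exact ⟨j, hj.trans hi, hj⟩
      · intro i hi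
        obtain ⟨j, hj, hj'⟩ := exists_between (show i < b from hi)
        exact ⟨j, hj', hj⟩
    · have := h.denselyOrdered
      refine h.restrict (h.noMax b) ordConnected_Ioi ?_ ?_
      · intro i hi
        obtain ⟨j, hj, hj'⟩ := exists_between (show b < i from hi)
        exact ⟨j, hj, hj'⟩
      · intro i hi
        obtain ⟨j, hj⟩ := h.noMax i
        exact ⟨j, lt_trans (show b < i from hi) hj, hj⟩
    · right
      refine ⟨b, ?_⟩
      rw [← inter_union_distrib_left]
      exact inter_eq_left.2 (hsub b)
  · push Not at hb
    have hlow : ∀ i j, (B i ∩ J).Nonempty → j < i → B j ⊆ J := by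
      rintro i j ⟨x, hxi, hxJ⟩ hji y hy
      exact (hsub j hy).resolve_right fun hyK =>
        lt_asymm (hJK x hxJ y hyK) (h.before j i hji y hy x hxi)
    have hup : ∀ i j, (B i ∩ K).Nonempty → i < j → B j ⊆ K := by
      rintro i j ⟨x, hxi, hxK⟩ hij y hy
      exact (hsub j hy).resolve_left fun hyJ =>
        lt_asymm (hJK y hyJ x hxK) (h.before i j hij x hxi y hy)
    have hor : ∀ i, B i ⊆ J ∨ B i ⊆ K := by
      intro i
      by_contra hcon
      push Not at hcon
      obtain ⟨⟨x, hx, hxJ⟩, ⟨y, hy, hyK⟩⟩ :=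
        And.intro (not_subset.1 hcon.1) (not_subset.1 hcon.2)
      have h₁ := (hsub i hx).resolve_left hxJ
      have h₂ := (hsub i hy).resolve_right hyK
      obtain ⟨j, hj, hj'⟩ := hb i fun j hj => hlow i j ⟨y, hy, h₂⟩ hj
      exact hj' (hup i j ⟨x, hx, h₁⟩ hj)
    have hmJ : ∀ i, ¬ B i ⊆ K → B i ⊆ J := fun i hi => (hor i).resolve_right hi
    have hmK : ∀ i, ¬ B i ⊆ J → B i ⊆ K := fun i hi => (hor i).resolve_left hi
    have hneJ : ∀ i, B i ⊆ J → (B i ∩ J).Nonempty := fun i hi =>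
      (hne i).mono (subset_inter Subset.rfl hi)
    have hneK : ∀ i, B i ⊆ K → (B i ∩ K).Nonempty := fun i hi =>
      (hne i).mono (subset_inter Subset.rfl hi)
    have hJeq : J = ⋃ i ∈ {i | B i ⊆ J}, B i := by
      refine Subset.antisymm (fun x hx => ?_) (iUnion₂_subset fun i hi => hi)
      obtain ⟨i, hi⟩ := h.exists_mem (hI ▸ Or.inl hx : x ∈ I)
      exact mem_biUnion (hmJ i fun hK => lt_irrefl _ (hJK x hx x (hK hi))) hi
    have hKeq : K = ⋃ i ∈ {i | B i ⊆ K}, B i := by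
      refine Subset.antisymm (fun x hx => ?_) (iUnion₂_subset fun i hi => hi)
      obtain ⟨i, hi⟩ := h.exists_mem (hI ▸ Or.inr hx : x ∈ I)
      exact mem_biUnion (hmK i fun hJ => lt_irrefl _ (hJK x (hJ hi) x hx)) hi
    refine ⟨J, ∅, ∅, K, by simp, fun _ _ _ h => h.elim, by simp, fun _ h => h.elim, ?_, ?_,
      Or.inl (by simp)⟩
    · rw [hJeq]
      refine h.restrict ?_ ⟨?_⟩ ?_ ?_
      · rw [hJeq] at hJ
        obtain ⟨i, hi, -⟩ := nonempty_biUnion.1 hJ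
        exact ⟨i, hi⟩
      · rintro i hi j hj l ⟨-, hl⟩
        rcases hl.eq_or_lt with rfl | hl
        · exact hj
        · exact hlow j l (hneJ j hj) hl
      · intro i hi
        obtain ⟨j, hj⟩ := h.noMin i
        exact ⟨j, hlow i j (hneJ i hi) hj, hj⟩
      · intro i hi
        obtain ⟨j, hj, hj'⟩ := hb i fun j hj => hlow i j (hneJ i hi) hj
        exact ⟨j, hmJ j hj', hj⟩
    · rw [hKeq]
      refine h.restrict ?_ ⟨?_⟩ ?_ ?_
      · rw [hKeq] at hK
        obtain ⟨i, hi, -⟩ := nonempty_biUnion.1 hK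
        exact ⟨i, hi⟩
      · rintro i hi j hj l ⟨hl, -⟩
        rcases hl.eq_or_lt with rfl | hl
        · exact hi
        · exact hup i l (hneK i hi) hl
      · intro i hi
        by_contra hcon
        push Not at hcon
        obtain ⟨j, hj, hj'⟩ := hb i fun j hj => hmJ j fun hjK => absurd hj (hcon j hjK).not_gt
        exact hj' (hup i j (hneK i hi) hj)
      · intro i hi
        obtain ⟨j, hj⟩ := h.noMax i
        exact ⟨j, hup i j (hneK i hi) hj, hj⟩

end Blocks

end Order

/-! ### Sets represented by terms, where some shuffles are regarded as atoms -/

section Rep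

variable {X : Type} [LinearOrder X]

open Classical in
/-- `Rep 𝒜 col t I`: the set `I` is represented by `t`, where the shuffles with class in `𝒜` are
regarded as atoms and represent single points of that colour. -/
def Rep (𝒜 : Set Term.Class) (col : X → Term.Class) : Term → Set X → Prop
  | .one, I => ∃ x, I = {x} ∧ col x = Term.one.cls
  | .cat s t, I => ∃ J K, Rep 𝒜 col s J ∧ Rep 𝒜 col t K ∧ Before J K ∧ I = J ∪ K
  | .shuffle s, I =>
    if (Term.shuffle s).cls ∈ 𝒜 then ∃ x, I = {x} ∧ col x = (Term.shuffle s).cls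
    else IsShuffle (fun i => Rep 𝒜 col (s i)) I

open Classical in
/-- The number of shuffles in a term that do not lie inside an atom. -/
noncomputable def numShuffles (𝒜 : Set Term.Class) : Term → ℕ
  | .one => 0
  | .cat s t => numShuffles 𝒜 s + numShuffles 𝒜 t
  | .shuffle s => if (Term.shuffle s).cls ∈ 𝒜 then 0 else 1 + ∑ i, numShuffles 𝒜 (s i)

variable {𝒜 : Set Term.Class} {col : X → Term.Class} {I : Set X} {m n : ℕ}
  {s : Fin (m + 1) → Term} {u : Fin (n + 1) → Term}

theorem rep_shuffle_of_mem (h : (Term.shuffle s).cls ∈ 𝒜) :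
    Rep 𝒜 col (.shuffle s) I ↔ ∃ x, I = {x} ∧ col x = (Term.shuffle s).cls := by
  rw [Rep, if_pos h]

theorem rep_shuffle_of_notMem (h : (Term.shuffle s).cls ∉ 𝒜) :
    Rep 𝒜 col (.shuffle s) I ↔ IsShuffle (fun i => Rep 𝒜 col (s i)) I := by
  rw [Rep, if_neg h]

theorem Rep.nonempty {t : Term} (h : Rep 𝒜 col t I) : I.Nonempty := by
  induction t generalizing I with
  | one =>
    obtain ⟨x, rfl, -⟩ := h
    exact singleton_nonempty x
  | cat s t hs ht =>
    obtain ⟨J, K, hJ, -, -, rfl⟩ := h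
    exact (hs hJ).inl
  | shuffle s ih =>
    by_cases hm : (Term.shuffle s).cls ∈ 𝒜
    · obtain ⟨x, rfl, -⟩ := (rep_shuffle_of_mem hm).1 h
      exact singleton_nonempty x
    · obtain ⟨ι, _, c, B, hB⟩ := (rep_shuffle_of_notMem hm).1 h
      obtain ⟨i⟩ := hB.nonempty
      exact (ih _ (hB.prop i)).mono (hB.subset i)

theorem Rep.exists_lt (hs : (Term.shuffle s).cls ∉ 𝒜) (h : Rep 𝒜 col (.shuffle s) I) {x : X}
    (hx : x ∈ I) : ∃ y ∈ I, y < x := by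
  obtain ⟨ι, _, c, B, hB⟩ := (rep_shuffle_of_notMem hs).1 h
  exact hB.exists_lt (fun i => (hB.prop i).nonempty) hx

theorem Rep.exists_gt (hs : (Term.shuffle s).cls ∉ 𝒜) (h : Rep 𝒜 col (.shuffle s) I) {x : X}
    (hx : x ∈ I) : ∃ y ∈ I, x < y := by
  obtain ⟨ι, _, c, B, hB⟩ := (rep_shuffle_of_notMem hs).1 h
  exact hB.exists_gt (fun i => (hB.prop i).nonempty) hx

theorem Rep.not_subset_singleton (hs : (Term.shuffle s).cls ∉ 𝒜) (h : Rep 𝒜 col (.shuffle s) I)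
    (x : X) : ¬ I ⊆ {x} := by
  intro hsub
  obtain ⟨y, hy⟩ := h.nonempty
  obtain ⟨z, hz, hzy⟩ := h.exists_lt hs hy
  rw [hsub hy, hsub hz] at hzy
  exact lt_irrefl _ hzy

theorem Rep.finite {t : Term} (ht : numShuffles 𝒜 t = 0) (h : Rep 𝒜 col t I) : I.Finite := by
  induction t generalizing I with
  | one =>
    obtain ⟨x, rfl, -⟩ := h
    exact finite_singleton x
  | cat s t hs ht' =>
    obtain ⟨J, K, hJ, hK, -, rfl⟩ := h
    rw [numShuffles, Nat.add_eq_zero_iff] at ht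
    exact (hs ht.1 hJ).union (ht' ht.2 hK)
  | shuffle s ih =>
    by_cases hm : (Term.shuffle s).cls ∈ 𝒜
    · obtain ⟨x, rfl, -⟩ := (rep_shuffle_of_mem hm).1 h
      exact finite_singleton x
    · rw [numShuffles, if_neg hm] at ht
      omega

/-- A shuffle that is not an atom has no greatest point, so it cannot describe a finite set. What
remains is a word of atoms, and each atom is coloured by its own class. -/
theorem Rep.cls_eq_of_finite {t : Term} (hI : I.Finite) (h : Rep 𝒜 col t I) :
    t.cls = wordProd col I := by
  induction t generalizing I with
  | one =>
    obtain ⟨x, rfl, hx⟩ := h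
    rw [wordProd_singleton, hx]
  | cat s t hs ht =>
    obtain ⟨J, K, hJ, hK, hJK, rfl⟩ := h
    have hJf := hI.subset subset_union_left
    have hKf := hI.subset subset_union_right
    rw [wordProd_union col hJf hKf hJK, Term.cls_cat, hs hJf hJ, ht hKf hK]
  | shuffle s ih =>
    by_cases hm : (Term.shuffle s).cls ∈ 𝒜
    · obtain ⟨x, rfl, hx⟩ := (rep_shuffle_of_mem hm).1 h
      rw [wordProd_singleton, hx]
    · obtain ⟨x, hx, hmax⟩ := hI.exists_maximal h.nonempty
      obtain ⟨y, hy, hxy⟩ := h.exists_gt hm hx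
      exact absurd (hmax hy hxy.le) hxy.not_ge

theorem rep_congr {s t : Term} (h : s.Same t) : Rep 𝒜 col s I ↔ Rep 𝒜 col t I := by
  induction h generalizing I with
  | refl s => rfl
  | symm _ ih => exact ih.symm
  | trans _ _ ih₁ ih₂ => exact ih₁.trans ih₂
  | assoc s t u =>
    constructor
    · rintro ⟨_, L, ⟨J, K, hJ, hK, hJK, rfl⟩, hL, hKL, rfl⟩
      refine ⟨J, K ∪ L, hJ, ⟨K, L, hK, hL, hKL.mono subset_union_right Subset.rfl, rfl⟩, ?_,
        union_assoc _ _ _⟩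
      rintro x hx y (hy | hy)
      exacts [hJK x hx y hy, hKL x (Or.inl hx) y hy]
    · rintro ⟨J, _, hJ, ⟨K, L, hK, hL, hKL, rfl⟩, hJK, rfl⟩
      refine ⟨J ∪ K, L, ⟨J, K, hJ, hK, hJK.mono Subset.rfl subset_union_left, rfl⟩, hL, ?_,
        (union_assoc _ _ _).symm⟩
      rintro x (hx | hx) y hy
      exacts [hJK x hx y (Or.inr hy), hKL x hx y hy]
  | cat_congr _ _ ih₁ ih₂ => simp only [Rep, ih₁, ih₂]
  | @shuffle_congr n s t h ih =>
    have heq := Term.cls_eq.2 (Term.Same.shuffle_congr h)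
    have hrep : (fun i => Rep 𝒜 col (s i)) = fun i => Rep 𝒜 col (t i) :=
      funext fun i => funext fun I => propext (ih i)
    by_cases hm : (Term.shuffle s).cls ∈ 𝒜
    · rw [rep_shuffle_of_mem hm, rep_shuffle_of_mem (heq ▸ hm), heq]
    · rw [rep_shuffle_of_notMem hm, rep_shuffle_of_notMem (heq ▸ hm), hrep]
  | @shuffle_perm n s e =>
    have heq := Term.cls_eq.2 (Term.Same.shuffle_perm s e)
    by_cases hm : (Term.shuffle s).cls ∈ 𝒜
    · rw [rep_shuffle_of_mem hm, rep_shuffle_of_mem (heq ▸ hm), heq]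
    · rw [rep_shuffle_of_notMem hm, rep_shuffle_of_notMem (heq ▸ hm)]
      constructor
      · rintro ⟨ι, _, c, B, hB⟩
        refine ⟨ι, _, fun i => e (c i), B, ⟨hB.nonempty, hB.noMin, hB.noMax, ?_, hB.before, hB.eq,
          hB.prop⟩⟩
        intro i j hij k
        obtain ⟨l, h₁, h₂, h₃⟩ := hB.dense i j hij (e.symm k)
        exact ⟨l, h₁, h₂, by rw [h₃, e.apply_symm_apply]⟩
      · rintro ⟨ι, _, c, B, hB⟩
        refine ⟨ι, _, fun i => e.symm (c i), B, ⟨hB.nonempty, hB.noMin, hB.noMax, ?_, hB.before,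
          hB.eq, ?_⟩⟩
        · intro i j hij k
          obtain ⟨l, h₁, h₂, h₃⟩ := hB.dense i j hij (e k)
          exact ⟨l, h₁, h₂, by rw [h₃, e.symm_apply_apply]⟩
        · intro i
          simpa using hB.prop i

/-! ### Occurrences of an innermost shuffle -/

/-- `ℚ(u)` is a shuffle of pairwise different words of atoms, and not itself an atom. -/
structure Innermost (𝒜 : Set Term.Class) (u : Fin (n + 1) → Term) : Prop where
  notMem : (Term.shuffle u).cls ∉ 𝒜
  word : ∀ i, numShuffles 𝒜 (u i) = 0
  distinct : ¬ HasRepetition u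

/-- `D` is a convex part of `I` that is represented by `t`. -/
structure IsPart (𝒜 : Set Term.Class) (col : X → Term.Class) (t : Term) (I D : Set X) : Prop where
  convex : ConvexIn I D
  rep : Rep 𝒜 col t D

/-- Copies of `ℚ(u)` in a set represented by `t` that have only finitely many points on one side
are visible in `t`. -/
def ShowsEnds (𝒜 : Set Term.Class) (col : X → Term.Class) (u : Fin (n + 1) → Term) (t : Term) :
    Prop :=
  ∀ Z A Y : Set X, Before Z A → Before A Y → Rep 𝒜 col (.shuffle u) A →
    Rep 𝒜 col t (Z ∪ A ∪ Y) → (Z.Finite ∨ Y.Finite) →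
    ∃ x y, t.cls = x * (Term.shuffle u).cls * y ∧ (Z.Finite → x = wordProd col Z) ∧
      (Y.Finite → y = wordProd col Y)

/-- The cut between `J` and `K` would divide a crossing copy into a copy `A`, at most one argument
of `u` split as `Q`, `Q'`, and a copy `A'`. Then `s` ends in `ℚ(u) ^ Q` and `t` begins with `Q' ^
ℚ(u)`, which is an absorption. -/
theorem part_subset_of_cat {s t : Term} (hu : Innermost 𝒜 u) (hs : ShowsEnds 𝒜 col u s)
    (ht : ShowsEnds 𝒜 col u t) (hn : ¬ HasAbsorption (.cat s t)) {J K D : Set X}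
    (hJ : Rep 𝒜 col s J) (hK : Rep 𝒜 col t K) (hJK : Before J K)
    (hD : IsPart 𝒜 col (.shuffle u) (J ∪ K) D) : D ⊆ J ∨ D ⊆ K := by
  by_contra hcon
  push Not at hcon
  obtain ⟨a, haD, haJ⟩ := not_subset.1 hcon.2
  obtain ⟨b, hbD, hbK⟩ := not_subset.1 hcon.1
  replace haJ := (hD.convex.subset haD).resolve_right haJ
  replace hbK := (hD.convex.subset hbD).resolve_left hbK
  obtain ⟨ι, _, c, B, hB⟩ := (rep_shuffle_of_notMem hu.notMem).1 hD.rep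
  have hDeq : D = (D ∩ J) ∪ (D ∩ K) := by
    rw [← inter_union_distrib_left, inter_eq_left.2 hD.convex.subset]
  obtain ⟨A, Q, Q', A', hA, hAQ, hA', hQA', hAs, hAs', hQ⟩ :=
    hB.cut (fun i => (hB.prop i).nonempty) hDeq
      (hJK.mono inter_subset_right inter_subset_right) ⟨a, haD, haJ⟩ ⟨b, hbD, hbK⟩
  rw [← rep_shuffle_of_notMem hu.notMem] at hAs hAs'
  have hfin : (Q ∪ Q').Finite := by
    rcases hQ with h | ⟨i, h⟩
    · rw [h]; exact finite_empty
    · rw [h]; exact (hB.prop i).finite (hu.word _)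
  have hQf := hfin.subset subset_union_left
  have hQf' := hfin.subset subset_union_right
  have hQJ : Q ⊆ J := (hA ▸ subset_union_right : Q ⊆ D ∩ J).trans inter_subset_right
  have hQK : Q' ⊆ K := (hA' ▸ subset_union_left : Q' ⊆ D ∩ K).trans inter_subset_right
  have hAJ : A ⊆ D ∩ J := hA ▸ subset_union_left
  have hAK : A' ⊆ D ∩ K := hA' ▸ subset_union_right
  have hτ : ∃ τ : Option (Fin (n + 1)), optCls (τ.map u) = wordProd col (Q ∪ Q') := by
    rcases hQ with h | ⟨i, h⟩
    · exact ⟨none, by rw [h, wordProd_empty]; rfl⟩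
    · exact ⟨some (c i), by rw [h] at hfin ⊢; exact (hB.prop i).cls_eq_of_finite hfin⟩
  obtain ⟨τ, hτ⟩ := hτ
  rw [wordProd_union col hQf hQf' (hJK.mono hQJ hQK)] at hτ
  -- As `D` is convex and reaches into `K`, nothing of `J` outside `D` lies above a point of `A`.
  have hZ : J = {x ∈ J | ∀ a ∈ A, x < a} ∪ A ∪ Q := by
    rw [union_assoc, ← hA]
    refine Subset.antisymm (fun x hx => ?_) (union_subset (sep_subset _ _) inter_subset_right)
    by_cases hxD : x ∈ D
    · exact Or.inr ⟨hxD, hx⟩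
    · refine Or.inl ⟨hx, fun a ha => ?_⟩
      by_contra hax
      rcases (not_lt.1 hax).eq_or_lt with rfl | hax
      · exact hxD (hAJ ha).1
      · exact hxD (hD.convex.mem a (hAJ ha).1 b hbD x (Or.inl hx) hax (hJK x hx b hbK))
  have hY : K = Q' ∪ A' ∪ {x ∈ K | ∀ a ∈ A', a < x} := by
    rw [← hA']
    refine Subset.antisymm (fun x hx => ?_) (union_subset inter_subset_right (sep_subset _ _))
    by_cases hxD : x ∈ D
    · exact Or.inl ⟨hxD, hx⟩
    · refine Or.inr ⟨hx, fun a' ha => ?_⟩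
      by_contra hax
      rcases (not_lt.1 hax).eq_or_lt with rfl | hax
      · exact hxD (hAK ha).1
      · exact hxD (hD.convex.mem a haD a' (hAK ha).1 x (Or.inr hx) (hJK a haJ x hx) hax)
  obtain ⟨x, y, hx, -, hy⟩ := hs _ A Q (fun _ hx => hx.2) hAQ hAs (hZ ▸ hJ) (Or.inr hQf)
  obtain ⟨x', y', hx', hy', -⟩ := ht Q' A' _ hQA' (fun _ hx _ hy => hy.2 _ hx) hAs' (hY ▸ hK)
    (Or.inl hQf')
  obtain ⟨o, rfl⟩ := exists_optCls x
  obtain ⟨o', rfl⟩ := exists_optCls y'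
  refine hn ⟨n, u, τ, o, o', Term.cls_eq.1 ?_⟩
  rw [cls_surround, Term.cls_cat, Term.cls_cat, cls_surround, hτ, hx, hx', hy hQf, hy' hQf']
  simp only [optCls, Option.elim_none, mul_assoc, one_mul]

/-- A run of at least two blocks of a shuffle of words contains a copy of the shuffle. -/
theorem singleton_or_isNested (hu : Innermost 𝒜 u) {ι : Type} [LinearOrder ι]
    {c : ι → Fin (n + 1)} {B : ι → Set X} (hB : Blocks (fun i => Rep 𝒜 col (u i)) c B I) {t : Term}
    (ht : ShowsEnds 𝒜 col u t) {S : Set ι} (hS : S.OrdConnected)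
    (hrep : Rep 𝒜 col t (⋃ j ∈ S, B j)) : (∃ j, S = {j}) ∨ IsNested u t := by
  have hSne : S.Nonempty := by
    obtain ⟨x, hx⟩ := hrep.nonempty
    obtain ⟨j, hj, -⟩ := mem_iUnion₂.1 hx
    exact ⟨j, hj⟩
  by_cases hsub : S.Subsingleton
  · exact Or.inl (exists_eq_singleton_iff_nonempty_subsingleton.2 ⟨hSne, hsub⟩)
  right
  have hend : ∀ E : Set ι, E.Subsingleton → (⋃ j ∈ E, B j).Finite ∧
      ∃ τ : Option (Fin (n + 1)), optCls (τ.map u) = wordProd col (⋃ j ∈ E, B j) := by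
    intro E hE
    rcases hE.eq_empty_or_singleton with rfl | ⟨j, rfl⟩
    · rw [biUnion_empty]
      exact ⟨finite_empty, none, (wordProd_empty col).symm⟩
    · rw [biUnion_singleton]
      have hf := (hB.prop j).finite (hu.word _)
      exact ⟨hf, some (c j), (hB.prop j).cls_eq_of_finite hf⟩
  -- The first and last block of the run, if they exist, become `τ₀` and `τ₁`; the blocks of `M`
  -- between them have no end and form a copy of `ℚ(u)`.
  set E₀ := {j | IsLeast S j} with hE₀
  set E₁ := {j | IsGreatest S j} with hE₁
  set M := {j ∈ S | (∃ i ∈ S, i < j) ∧ ∃ i ∈ S, j < i} with hM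
  obtain ⟨hf₀, τ₀, hτ₀⟩ := hend E₀ fun i hi j hj => hi.unique hj
  obtain ⟨hf₁, τ₁, hτ₁⟩ := hend E₁ fun i hi j hj => hi.unique hj
  have hdense := hB.denselyOrdered
  have hmid : ∀ i ∈ S, ∀ j ∈ S, i < j → ∃ l ∈ M, i < l ∧ l < j := by
    intro i hi j hj hij
    obtain ⟨l, h₁, h₂⟩ := exists_between hij
    exact ⟨l, ⟨hS.out hi hj ⟨h₁.le, h₂.le⟩, ⟨i, hi, h₁⟩, ⟨j, hj, h₂⟩⟩, h₁, h₂⟩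
  have hMs : IsShuffle (fun i => Rep 𝒜 col (u i)) (⋃ j ∈ M, B j) := by
    refine hB.restrict ?_ ⟨?_⟩ ?_ ?_
    · rw [not_subsingleton_iff] at hsub
      obtain ⟨i, hi, j, hj, hij⟩ := hsub.exists_lt
      obtain ⟨l, hl, -⟩ := hmid i hi j hj hij
      exact ⟨l, hl⟩
    · rintro i ⟨hi, ⟨i', hi', h₁⟩, -⟩ j ⟨hj, -, ⟨j', hj', h₂⟩⟩ l ⟨hl, hl'⟩
      exact ⟨hS.out hi hj ⟨hl, hl'⟩, ⟨i', hi', h₁.trans_le hl⟩, ⟨j', hj', hl'.trans_lt h₂⟩⟩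
    · rintro i ⟨hi, ⟨j, hj, hji⟩, -⟩
      obtain ⟨l, hl, -, hli⟩ := hmid j hj i hi hji
      exact ⟨l, hl, hli⟩
    · rintro i ⟨hi, -, ⟨j, hj, hij⟩⟩
      obtain ⟨l, hl, hil, -⟩ := hmid i hi j hj hij
      exact ⟨l, hl, hil⟩
  have hSeq : S = E₀ ∪ M ∪ E₁ := by
    ext j
    constructor
    · intro hj
      by_cases h₀ : j ∈ E₀
      · exact Or.inl (Or.inl h₀)
      by_cases h₁ : j ∈ E₁
      · exact Or.inr h₁
      refine Or.inl (Or.inr ⟨hj, ?_, ?_⟩)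
      · by_contra hcon
        push Not at hcon
        exact h₀ ⟨hj, fun i hi => hcon i hi⟩
      · by_contra hcon
        push Not at hcon
        exact h₁ ⟨hj, fun i hi => hcon i hi⟩
    · rintro ((hj | hj) | hj)
      exacts [hj.1, hj.1, hj.1]
  have hb : ∀ E E' : Set ι, (∀ i ∈ E, ∀ j ∈ E', i < j) →
      Before (⋃ j ∈ E, B j) (⋃ j ∈ E', B j) := by
    intro E E' h x hx y hy
    obtain ⟨i, hi, hx⟩ := mem_iUnion₂.1 hx
    obtain ⟨j, hj, hy⟩ := mem_iUnion₂.1 hy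
    exact hB.before i j (h i hi j hj) x hx y hy
  rw [hSeq, biUnion_union, biUnion_union] at hrep
  obtain ⟨x, y, hxy, hx, hy⟩ := ht _ _ _
    (hb E₀ M fun i hi j ⟨hj, ⟨k, hk, hkj⟩, _⟩ => (hi.2 hk).trans_lt hkj)
    (hb M E₁ fun i ⟨hi, _, ⟨k, hk, hik⟩⟩ j hj => hik.trans_le (hj.2 hk))
    ((rep_shuffle_of_notMem hu.notMem).2 hMs) hrep (Or.inl hf₀)
  exact ⟨τ₀, τ₁, Term.cls_eq.1 (by rw [cls_surround, hτ₀, hτ₁, hxy, hx hf₀, hy hf₁])⟩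

/-- If `D` meets two blocks, it contains all blocks between them, and these show every colour. Each
finite block of `D` lies in one block of `I`, so each of those blocks of `I` is a run of blocks of
`D`. A run of length one gives an argument of `u`, a longer one a nested term. The latter is
excluded by `hn`, so the blocks coincide and the shuffles have the same arguments. -/
theorem part_subset_of_shuffle (hu : Innermost 𝒜 u) (hs : ∀ i, ShowsEnds 𝒜 col u (s i))
    (hrp : ¬ HasRepetition s) (hn : ¬ HasNesting s) {ι : Type} [LinearOrder ι]
    {c : ι → Fin (m + 1)} {B : ι → Set X} (hB : Blocks (fun i => Rep 𝒜 col (s i)) c B I) {D : Set X}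
    (hD : IsPart 𝒜 col (.shuffle u) I D) :
    (∃ i, D ⊆ B i) ∨ (Term.shuffle s).cls = (Term.shuffle u).cls := by
  by_cases hcon : ∃ i, D ⊆ B i
  · exact Or.inl hcon
  right
  push Not at hcon
  have hne : ∀ i, (B i).Nonempty := fun i => (hB.prop i).nonempty
  obtain ⟨q₀, q₁, x, y, hx, hxD, hy, hyD, hq⟩ : ∃ q₀ q₁ x y, x ∈ B q₀ ∧ x ∈ D ∧ y ∈ B q₁ ∧ y ∈ D ∧
      q₀ < q₁ := by
    obtain ⟨x, hx⟩ := hD.rep.nonempty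
    obtain ⟨i, hi⟩ := hB.exists_mem (hD.convex.subset hx)
    obtain ⟨y, hy, hyi⟩ := not_subset.1 (hcon i)
    obtain ⟨j, hj⟩ := hB.exists_mem (hD.convex.subset hy)
    rcases lt_trichotomy i j with hij | rfl | hij
    · exact ⟨i, j, x, y, hi, hx, hj, hy, hij⟩
    · exact absurd hj hyi
    · exact ⟨j, i, y, x, hj, hy, hi, hx, hij⟩
  have hBD : ∀ q, q₀ < q → q < q₁ → B q ⊆ D := fun q h₀ h₁ z hz =>
    hD.convex.mem x hxD y hyD z (hB.subset q hz) (hB.before _ _ h₀ x hx z hz)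
      (hB.before _ _ h₁ z hz y hy)
  obtain ⟨κ, _, d, E, hE⟩ := (rep_shuffle_of_notMem hu.notMem).1 hD.rep
  have hEf : ∀ j, (E j).Finite := fun j => (hE.prop j).finite (hu.word _)
  have hEne : ∀ j, (E j).Nonempty := fun j => (hE.prop j).nonempty
  have hEB : ∀ j, ∃ q, E j ⊆ B q := fun j =>
    hB.exists_subset_of_finite hne (hEf j) (hEne j) (hD.convex.trans (hE.convexIn j))
  have hBE : ∀ q, q₀ < q → q < q₁ → ⋃ j ∈ {j | E j ⊆ B q}, E j = B q := by
    intro q h₀ h₁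
    refine Subset.antisymm (iUnion₂_subset fun j hj => hj) fun z hz => ?_
    obtain ⟨j, hj⟩ := hE.exists_mem (hBD q h₀ h₁ hz)
    obtain ⟨q', hq'⟩ := hEB j
    have : q' = q := hB.index_unique (hq' hj) hz
    exact mem_biUnion (show E j ⊆ B q from this ▸ hq') hj
  have hord : ∀ q, OrdConnected {j | E j ⊆ B q} := by
    refine fun q => ⟨fun i hi j hj l hl => ?_⟩
    rcases hl.1.eq_or_lt with rfl | h₁
    · exact hi
    rcases hl.2.eq_or_lt with rfl | h₂
    · exact hj
    obtain ⟨a, ha⟩ := hEne i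
    obtain ⟨b, hb⟩ := hEne j
    obtain ⟨q', hq'⟩ := hEB l
    obtain ⟨z, hz⟩ := hEne l
    have : q' = q := le_antisymm
      (hB.le_of_le (hq' hz) (hj hb) (hE.before l j h₂ z hz b hb).le)
      (hB.le_of_le (hi ha) (hq' hz) (hE.before i l h₁ a ha z hz).le)
    exact this ▸ hq'
  have hblock : ∀ q, q₀ < q → q < q₁ → (∃ j, E j = B q) ∨ IsNested u (s (c q)) := by
    intro q h₀ h₁
    refine (singleton_or_isNested hu hE (hs (c q)) (hord q) ?_).imp ?_ id
    · rw [hBE q h₀ h₁]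
      exact hB.prop q
    · rintro ⟨j, hj⟩
      refine ⟨j, ?_⟩
      rw [← hBE q h₀ h₁, hj, biUnion_singleton]
  have hEcls : ∀ j q, E j = B q → (s (c q)).cls = (u (d j)).cls := by
    intro j q h
    rw [(hE.prop j).cls_eq_of_finite (hEf j), (hB.prop q).cls_eq_of_finite (h ▸ hEf j), h]
  have hnot : ∀ i, ¬ IsNested u (s i) := by
    intro i hi
    refine hn ⟨n, u, fun k => ?_, i, hi⟩
    obtain ⟨q, h₀, h₁, rfl⟩ := hB.dense q₀ q₁ hq k
    refine (hblock q h₀ h₁).imp ?_ id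
    rintro ⟨j, hj⟩
    exact ⟨d j, Term.cls_eq.1 (hEcls j q hj)⟩
  have hblock' : ∀ q, q₀ < q → q < q₁ → ∃ j, E j = B q := fun q h₀ h₁ =>
    (hblock q h₀ h₁).resolve_right (hnot _)
  refine cls_shuffle_congr hrp hu.distinct (fun k => ?_) fun k => ?_
  · obtain ⟨q, h₀, h₁, rfl⟩ := hB.dense q₀ q₁ hq k
    obtain ⟨j, hj⟩ := hblock' q h₀ h₁
    exact ⟨d j, hEcls j q hj⟩
  -- For the converse inclusion, a block of `D` of colour `k` is found between two common blocks;
  -- the block of `I` around it is again a common one.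
  · obtain ⟨q, h₀, h₁, -⟩ := hB.dense q₀ q₁ hq (c q₀)
    obtain ⟨q', h₀', h₁', -⟩ := hB.dense q q₁ h₁ (c q₀)
    obtain ⟨i, hi⟩ := hblock' q h₀ h₁
    obtain ⟨j, hj⟩ := hblock' q' (h₀.trans h₀') h₁'
    obtain ⟨a, ha⟩ := hEne i
    obtain ⟨b, hb⟩ := hEne j
    have hij : i < j := by
      by_contra hij
      rcases (not_lt.1 hij).eq_or_lt with rfl | hij
      · exact h₀'.ne (hB.index_unique (hi ▸ ha) (hj ▸ ha))
      · exact lt_asymm (hE.before j i hij b hb a ha) (hB.before q q' h₀' a (hi ▸ ha) b (hj ▸ hb))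
    obtain ⟨l, hil, hlj, rfl⟩ := hE.dense i j hij k
    obtain ⟨z, hz⟩ := hEne l
    obtain ⟨r, hr⟩ := hEB l
    have hqr : q ≤ r := hB.le_of_le (hi ▸ ha) (hr hz) (hE.before i l hil a ha z hz).le
    have hrq : r ≤ q' := hB.le_of_le (hr hz) (hj ▸ hb) (hE.before l j hlj z hz b hb).le
    obtain ⟨l', hl'⟩ := hblock' r (h₀.trans_le hqr) (hrq.trans_lt h₁')
    have : l' = l := hE.index_unique (by rw [hl']; exact hr hz) hz
    exact ⟨c r, hEcls l r (this ▸ hl')⟩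

end Rep

/-! ### Copies of an innermost shuffle in a normal form -/

section Collapse

variable {X : Type} [LinearOrder X] {𝒜 : Set Term.Class} {col : X → Term.Class} {I : Set X}
  {m n : ℕ} {s : Fin (m + 1) → Term} {u : Fin (n + 1) → Term}

theorem convexIn_middle {Z A Y : Set X} (h : Before Z A) (h' : Before A Y) :
    ConvexIn (Z ∪ A ∪ Y) A where
  subset := fun _ hx => Or.inl (Or.inr hx)
  mem := by
    rintro x hx z hz y ((hy | hy) | hy) hxy hyz
    · exact absurd (h y hy x hx) hxy.not_gt
    · exact hy
    · exact absurd (h' z hz y hy) hyz.not_gt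

/-- In a concatenation the copy lies in one factor, and the other factor belongs to a single side,
contributing its word when that side is finite. A shuffle that is not an atom has no endpoints, so a
finite side is empty; the copy then cannot lie in one block, and the shuffle is `ℚ(u)`. -/
theorem showsEnds (hu : Innermost 𝒜 u) {t : Term} (ht : t.IsNormalForm) :
    ShowsEnds 𝒜 col u t := by
  induction t with
  | one =>
    rintro Z A Y - - hA ⟨x, hx, -⟩ -
    exact absurd (fun a ha => hx ▸ Or.inl (Or.inr ha)) (hA.not_subset_singleton hu.notMem x)
  | cat s t ihs iht =>
    obtain ⟨hs, ht, hn⟩ := ht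
    rintro Z A Y hZA hAY hA ⟨J, K, hJ, hK, hJK, hI⟩ hfin
    have hpart : IsPart 𝒜 col (.shuffle u) (J ∪ K) A := ⟨hI ▸ convexIn_middle hZA hAY, hA⟩
    obtain ⟨a, ha⟩ := hA.nonempty
    have hmem : ∀ {x}, x ∈ J ∪ K → (x ∈ Z ∨ x ∈ A) ∨ x ∈ Y := fun {x} hx =>
      hI.symm.subset hx
    have hZ : Z ⊆ J ∪ K := fun x hx => hI ▸ Or.inl (Or.inl hx)
    have hY : Y ⊆ J ∪ K := fun x hx => hI ▸ Or.inr hx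
    rcases part_subset_of_cat hu (ihs hs) (iht ht) hn hJ hK hJK hpart with hAJ | hAK
    · have hKY : K ⊆ Y := by
        intro x hx
        have hax := hJK a (hAJ ha) x hx
        refine (hmem (Or.inr hx)).resolve_left ?_
        rintro (h | h)
        · exact lt_asymm hax (hZA x h a ha)
        · exact lt_irrefl _ (hJK x (hAJ h) x hx)
      have hZJ : Z ⊆ J := fun x hx => (hZ hx).resolve_right fun hxK =>
        lt_asymm (hJK a (hAJ ha) x hxK) (hZA x hx a ha)
      have hYeq : Y = (Y ∩ J) ∪ K := by
        refine Subset.antisymm (fun x hx => ?_) (union_subset inter_subset_left hKY)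
        exact (hY hx).imp (fun h => ⟨hx, h⟩) id
      have hJeq : J = Z ∪ A ∪ (Y ∩ J) := by
        refine Subset.antisymm (fun x hx => ?_)
          (union_subset (union_subset hZJ hAJ) inter_subset_right)
        exact (hmem (Or.inl hx)).imp id fun h => ⟨h, hx⟩
      obtain ⟨x, y, hxy, hx, hy⟩ := ihs hs Z A (Y ∩ J) hZA (hAY.mono Subset.rfl inter_subset_left)
        hA (hJeq ▸ hJ) (hfin.imp id fun h => h.subset inter_subset_left)
      refine ⟨x, y * t.cls, by rw [Term.cls_cat, hxy, mul_assoc], hx, fun h => ?_⟩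
      have h₁ := h.subset (inter_subset_left : Y ∩ J ⊆ Y)
      have h₂ := h.subset hKY
      rw [hYeq, wordProd_union col h₁ h₂ (hJK.mono inter_subset_right Subset.rfl), hy h₁,
        hK.cls_eq_of_finite h₂]
    · have hJZ : J ⊆ Z := by
        intro x hx
        have hax := hJK x hx a (hAK ha)
        rcases hmem (Or.inl hx) with (h | h) | h
        · exact h
        · exact absurd (hJK x hx x (hAK h)) (lt_irrefl _)
        · exact absurd (hAY a ha x h) hax.not_gt
      have hYK : Y ⊆ K := fun x hx => (hY hx).resolve_left fun hxJ =>
        lt_asymm (hJK x hxJ a (hAK ha)) (hAY a ha x hx)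
      have hZeq : Z = J ∪ (Z ∩ K) := by
        refine Subset.antisymm (fun x hx => ?_) (union_subset hJZ inter_subset_left)
        exact (hZ hx).imp id fun h => ⟨hx, h⟩
      have hKeq : K = (Z ∩ K) ∪ A ∪ Y := by
        refine Subset.antisymm (fun x hx => ?_)
          (union_subset (union_subset inter_subset_right hAK) hYK)
        exact (hmem (Or.inr hx)).imp (fun h => h.imp (fun h => ⟨h, hx⟩) id) id
      obtain ⟨x, y, hxy, hx, hy⟩ := iht ht (Z ∩ K) A Y (hZA.mono inter_subset_left Subset.rfl) hAY
        hA (hKeq ▸ hK) (hfin.imp (fun h => h.subset inter_subset_left) id)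
      refine ⟨s.cls * x, y, by rw [Term.cls_cat, hxy]; simp only [mul_assoc], fun h => ?_, hy⟩
      have h₁ := h.subset (inter_subset_left : Z ∩ K ⊆ Z)
      have h₂ := h.subset hJZ
      rw [hZeq, wordProd_union col h₂ h₁ (hJK.mono Subset.rfl inter_subset_right), hx h₁,
        hJ.cls_eq_of_finite h₂]
  | shuffle s ih =>
    obtain ⟨hs, hrp, hn⟩ := ht
    intro Z A Y hZA hAY hA hI hfin
    by_cases hm : (Term.shuffle s).cls ∈ 𝒜
    · obtain ⟨x, hx, -⟩ := (rep_shuffle_of_mem hm).1 hI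
      exact absurd (fun a ha => hx ▸ Or.inl (Or.inr ha)) (hA.not_subset_singleton hu.notMem x)
    obtain ⟨a, ha⟩ := hA.nonempty
    have hZ₀ : Z.Finite → Z = ∅ := by
      intro hf
      by_contra hne
      obtain ⟨x, hx, hmin⟩ := hf.exists_minimal (nonempty_iff_ne_empty.2 hne)
      obtain ⟨y, (hy | hy) | hy, hyx⟩ := hI.exists_lt hm (Or.inl (Or.inl hx))
      · exact absurd (hmin hy hyx.le) hyx.not_ge
      · exact lt_asymm hyx (hZA x hx y hy)
      · exact lt_asymm hyx ((hZA x hx a ha).trans (hAY a ha y hy))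
    have hY₀ : Y.Finite → Y = ∅ := by
      intro hf
      by_contra hne
      obtain ⟨x, hx, hmax⟩ := hf.exists_maximal (nonempty_iff_ne_empty.2 hne)
      obtain ⟨y, (hy | hy) | hy, hyx⟩ := hI.exists_gt hm (Or.inr hx)
      · exact lt_asymm hyx ((hZA y hy a ha).trans (hAY a ha x hx))
      · exact lt_asymm hyx (hAY y hy x hx)
      · exact absurd (hmax hy hyx.le) hyx.not_ge
    obtain ⟨ι, _, c, B, hB⟩ := (rep_shuffle_of_notMem hm).1 hI
    have hcls : (Term.shuffle s).cls = (Term.shuffle u).cls := by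
      refine (part_subset_of_shuffle hu (fun i => ih i (hs i)) hrp hn hB
        ⟨convexIn_middle hZA hAY, hA⟩).resolve_left ?_
      -- On the empty side of `A` there is still a block beyond the one containing `A`.
      rintro ⟨i, hi⟩
      rcases hfin with hf | hf
      · obtain ⟨j, hj⟩ := hB.noMin i
        obtain ⟨y, hy⟩ := (hB.prop j).nonempty
        have hya := hB.before j i hj y hy a (hi ha)
        rcases hB.subset j hy with (h | h) | h
        · rw [hZ₀ hf] at h
          exact h
        · exact hj.ne (hB.index_unique hy (hi h))
        · exact lt_asymm hya (hAY a ha y h)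
      · obtain ⟨j, hj⟩ := hB.noMax i
        obtain ⟨y, hy⟩ := (hB.prop j).nonempty
        have hya := hB.before i j hj a (hi ha) y hy
        rcases hB.subset j hy with (h | h) | h
        · exact lt_asymm hya (hZA y h a ha)
        · exact hj.ne (hB.index_unique (hi h) hy)
        · rw [hY₀ hf] at h
          exact h
    refine ⟨1, 1, by rw [hcls, one_mul, mul_one], fun h => ?_, fun h => ?_⟩
    · rw [hZ₀ h, wordProd_empty]
    · rw [hY₀ h, wordProd_empty]

/-! ### Collapsing the copies of an innermost shuffle to points -/

theorem IsPart.of_subset {t : Term} {J D : Set X} (h : IsPart 𝒜 col t I D) (hJ : J ⊆ I)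
    (hD : D ⊆ J) : IsPart 𝒜 col t J D :=
  ⟨h.convex.of_subset hJ hD, h.rep⟩

theorem IsPart.trans {t : Term} {J D : Set X} (h : IsPart 𝒜 col t J D) (hJ : ConvexIn I J) :
    IsPart 𝒜 col t I D :=
  ⟨hJ.trans h.convex, h.rep⟩

/-- `J` is a convex part of `I` that contains every copy of `ℚ(u)` in `I` that it meets. -/
structure Saturated (𝒜 : Set Term.Class) (col : X → Term.Class) (u : Fin (n + 1) → Term)
    (I J : Set X) : Prop where
  convex : ConvexIn I J
  subset : ∀ D, IsPart 𝒜 col (.shuffle u) I D → ∀ x ∈ D, x ∈ J → D ⊆ J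

theorem saturated_cat (hu : Innermost 𝒜 u) {s t : Term} (h : (Term.cat s t).IsNormalForm)
    {J K : Set X} (hJ : Rep 𝒜 col s J) (hK : Rep 𝒜 col t K) (hJK : Before J K) :
    Saturated 𝒜 col u (J ∪ K) J ∧ Saturated 𝒜 col u (J ∪ K) K := by
  obtain ⟨hs, ht, hn⟩ := h
  have key := fun D hD => part_subset_of_cat hu (showsEnds hu hs) (showsEnds hu ht) hn hJ hK hJK
    (D := D) hD
  refine ⟨⟨hJK.convexIn_left, fun D hD x hx hxJ => ?_⟩,
    ⟨hJK.convexIn_right, fun D hD x hx hxK => ?_⟩⟩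
  · exact (key D hD).resolve_right fun h => lt_irrefl _ (hJK x hxJ x (h hx))
  · exact (key D hD).resolve_left fun h => lt_irrefl _ (hJK x (h hx) x hxK)

theorem saturated_shuffle (hu : Innermost 𝒜 u) (h : (Term.shuffle s).IsNormalForm)
    (hne : (Term.shuffle s).cls ≠ (Term.shuffle u).cls) {ι : Type} [LinearOrder ι]
    {c : ι → Fin (m + 1)} {B : ι → Set X} (hB : Blocks (fun i => Rep 𝒜 col (s i)) c B I) (i : ι) :
    Saturated 𝒜 col u I (B i) := by
  obtain ⟨hs, hrp, hn⟩ := h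
  refine ⟨hB.convexIn i, fun D hD x hx hxi => ?_⟩
  obtain ⟨j, hj⟩ := (part_subset_of_shuffle hu (fun i => showsEnds hu (hs i)) hrp hn hB
    hD).resolve_right hne
  exact hB.index_unique (hj hx) hxi ▸ hj

/-- A copy of `ℚ(u)` in `I` that is saturated: the block of all points identified with its
points. -/
structure IsMaxPart (𝒜 : Set Term.Class) (col : X → Term.Class) (u : Fin (n + 1) → Term)
    (I D : Set X) : Prop extends IsPart 𝒜 col (.shuffle u) I D, Saturated 𝒜 col u I D

theorem IsMaxPart.trans {J D : Set X} (h : IsMaxPart 𝒜 col u J D) (hJ : Saturated 𝒜 col u I J) :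
    IsMaxPart 𝒜 col u I D where
  toIsPart := h.toIsPart.trans hJ.convex
  subset E hE x hx hxD := h.subset E
    (hE.of_subset hJ.convex.subset (hJ.subset E hE x hx (h.toIsPart.convex.subset hxD))) x hx hxD

/-- `R` consists of one point of every maximal copy of `ℚ(u)` in `I`, recoloured by `ℚ(u)`, and of
the points of `I` that lie in no copy. -/
structure Collapses (𝒜 : Set Term.Class) (col : X → Term.Class) (u : Fin (n + 1) → Term)
    (I R : Set X) (col' : X → Term.Class) : Prop where
  exists_mem : ∀ D, IsMaxPart 𝒜 col u I D → ∃ r ∈ R, r ∈ D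
  unique : ∀ D, IsPart 𝒜 col (.shuffle u) I D → ∀ r ∈ R, ∀ r' ∈ R, r ∈ D → r' ∈ D → r = r'
  color : ∀ D, IsPart 𝒜 col (.shuffle u) I D → ∀ r ∈ D, col' r = (Term.shuffle u).cls
  mem_of_notMem : ∀ x ∈ I, (∀ D, IsPart 𝒜 col (.shuffle u) I D → x ∉ D) → x ∈ R ∧ col' x = col x

/-- Saturation makes collapsing local, so one choice of `R` and `col'` for `I` serves all the pieces
given by a term. -/
theorem Collapses.restrict {R J : Set X} {col' : X → Term.Class}
    (h : Collapses 𝒜 col u I R col') (hJ : Saturated 𝒜 col u I J) :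
    Collapses 𝒜 col u J R col' where
  exists_mem D hD := h.exists_mem D (hD.trans hJ)
  unique D hD := h.unique D (hD.trans hJ.convex)
  color D hD := h.color D (hD.trans hJ.convex)
  mem_of_notMem x hx hn := h.mem_of_notMem x (hJ.convex.subset hx) fun D hD hxD =>
    hn D (hD.of_subset hJ.convex.subset (hJ.subset D hD x hxD hx)) hxD

theorem exists_collapses {t : Term} (hI : Rep 𝒜 col t I) (u : Fin (n + 1) → Term) :
    ∃ R col', Collapses 𝒜 col u I R col' := by
  classical
  have : Nonempty X := ⟨hI.nonempty.some⟩
  choose! f hf using fun (D : Set X) (h : D.Nonempty) => h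
  refine ⟨{x | (∀ D, IsPart 𝒜 col (.shuffle u) I D → x ∉ D) ∨
    ∃ D, IsMaxPart 𝒜 col u I D ∧ x = f D},
    fun x => if ∃ D, IsPart 𝒜 col (.shuffle u) I D ∧ x ∈ D then (Term.shuffle u).cls else col x,
    ?_, ?_, ?_, ?_⟩
  · exact fun D hD => ⟨f D, Or.inr ⟨D, hD, rfl⟩, hf D hD.rep.nonempty⟩
  · intro D hD r hr r' hr' hrD hrD'
    -- Two maximal copies that meet the same copy `D` both contain it, hence coincide; the chosen
    -- point depends only on the set.
    obtain ⟨E, hE, rfl⟩ := hr.resolve_left fun h => h D hD hrD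
    obtain ⟨E', hE', rfl⟩ := hr'.resolve_left fun h => h D hD hrD'
    have h₁ := hf E hE.rep.nonempty
    have h₂ := hf E' hE'.rep.nonempty
    have h₃ := hE.subset D hD _ hrD h₁
    have h₄ := hE'.subset D hD _ hrD' h₂
    rw [Subset.antisymm (hE'.subset E hE.toIsPart _ h₁ (h₄ hrD))
      (hE.subset E' hE'.toIsPart _ h₂ (h₃ hrD'))]
  · intro D hD r hr
    exact if_pos ⟨D, hD, hr⟩
  · intro x hx hn
    exact ⟨Or.inl hn, if_neg fun ⟨D, hD, hxD⟩ => hn D hD hxD⟩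

/-- The pieces of a normal form are saturated, so the collapse can be carried out in each piece. It
takes effect where the term has `ℚ(u)` itself: that piece is a copy, trivially maximal within
itself, and shrinks to one point. -/
theorem Rep.collapse (hu : Innermost 𝒜 u) {R : Set X} {col' : X → Term.Class} {t : Term}
    (ht : t.IsNormalForm) (hI : Rep 𝒜 col t I) (hR : Collapses 𝒜 col u I R col') :
    Rep (insert (Term.shuffle u).cls 𝒜) col' t (I ∩ R) := by
  have hatom : ∀ x, Collapses 𝒜 col u {x} R col' → ({x} ∩ R = {x} ∧ col' x = col x) := by
    intro x h
    obtain ⟨h₁, h₂⟩ := h.mem_of_notMem x rfl fun D hD _ =>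
      hD.rep.not_subset_singleton hu.notMem x hD.convex.subset
    exact ⟨inter_eq_left.2 (singleton_subset_iff.2 h₁), h₂⟩
  induction t generalizing I with
  | one =>
    obtain ⟨x, rfl, hx⟩ := hI
    obtain ⟨h₁, h₂⟩ := hatom x hR
    exact ⟨x, h₁, h₂.trans hx⟩
  | cat s t ihs iht =>
    obtain ⟨J, K, hJ, hK, hJK, rfl⟩ := hI
    obtain ⟨h₁, h₂⟩ := saturated_cat hu ht hJ hK hJK
    exact ⟨J ∩ R, K ∩ R, ihs ht.1 hJ (hR.restrict h₁), iht ht.2.1 hK (hR.restrict h₂),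
      hJK.mono inter_subset_left inter_subset_left, union_inter_distrib_right _ _ _⟩
  | shuffle s ih =>
    by_cases hm : (Term.shuffle s).cls ∈ 𝒜
    · rw [rep_shuffle_of_mem (mem_insert_of_mem _ hm)]
      obtain ⟨x, rfl, hx⟩ := (rep_shuffle_of_mem hm).1 hI
      obtain ⟨h₁, h₂⟩ := hatom x hR
      exact ⟨x, h₁, h₂.trans hx⟩
    by_cases heq : (Term.shuffle s).cls = (Term.shuffle u).cls
    · rw [rep_shuffle_of_mem (heq ▸ mem_insert _ _)]
      have hpart : IsPart 𝒜 col (.shuffle u) I I :=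
        ⟨⟨Subset.rfl, fun _ _ _ _ _ hy _ _ => hy⟩, (rep_congr (Term.cls_eq.1 heq)).1 hI⟩
      obtain ⟨r, hrR, hrI⟩ := hR.exists_mem I
        ⟨hpart, fun D hD _ _ _ => hD.convex.subset⟩
      refine ⟨r, ?_, (hR.color I hpart r hrI).trans heq.symm⟩
      exact Subset.antisymm (fun x hx => hR.unique I hpart x hx.2 r hrR hx.1 hrI)
        (singleton_subset_iff.2 ⟨hrI, hrR⟩)
    · rw [rep_shuffle_of_notMem (by simp [heq, hm])]
      obtain ⟨ι, _, c, B, hB⟩ := (rep_shuffle_of_notMem hm).1 hI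
      refine ⟨ι, _, c, fun i => B i ∩ R, hB.nonempty, hB.noMin, hB.noMax, hB.dense, ?_, ?_, ?_⟩
      · exact fun i j hij => (hB.before i j hij).mono inter_subset_left inter_subset_left
      · rw [hB.eq, iUnion_inter]
      · exact fun i => ih _ (ht.1 _) (hB.prop i) (hR.restrict (saturated_shuffle hu ht heq hB i))

end Collapse

/-! ### Uniqueness -/

theorem numShuffles_anti {𝒜 𝒜' : Set Term.Class} (h : 𝒜 ⊆ 𝒜') (t : Term) :
    numShuffles 𝒜' t ≤ numShuffles 𝒜 t := by
  induction t with
  | one => rfl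
  | cat s t hs ht => exact Nat.add_le_add hs ht
  | shuffle s ih =>
    rw [numShuffles, numShuffles]
    split_ifs with h₁ h₂ h₂
    · rfl
    · exact Nat.zero_le _
    · exact absurd (h h₂) h₁
    · exact Nat.add_le_add_left (Finset.sum_le_sum fun i _ => ih i) 1

theorem exists_innermost {𝒜 : Set Term.Class} {t : Term} (ht : t.IsNormalForm)
    (h : numShuffles 𝒜 t ≠ 0) : ∃ (n : ℕ) (u : Fin (n + 1) → Term), Innermost 𝒜 u ∧
      numShuffles (insert (Term.shuffle u).cls 𝒜) t < numShuffles 𝒜 t := by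
  induction t with
  | one => exact absurd rfl h
  | cat s t ihs iht =>
    by_cases hs : numShuffles 𝒜 s = 0
    · obtain ⟨n, u, hu, hlt⟩ := iht ht.2.1 fun h' => h (by rw [numShuffles, hs, h'])
      exact ⟨n, u, hu, Nat.add_lt_add_of_le_of_lt (numShuffles_anti (subset_insert _ _) s) hlt⟩
    · obtain ⟨n, u, hu, hlt⟩ := ihs ht.1 hs
      exact ⟨n, u, hu, Nat.add_lt_add_of_lt_of_le hlt (numShuffles_anti (subset_insert _ _) t)⟩
  | shuffle s ih =>
    have hm : (Term.shuffle s).cls ∉ 𝒜 := fun hm => h (by rw [numShuffles, if_pos hm])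
    by_cases hs : ∀ i, numShuffles 𝒜 (s i) = 0
    · refine ⟨_, s, ⟨hm, hs, ht.2.1⟩, ?_⟩
      rw [numShuffles, if_pos (mem_insert _ _)]
      exact Nat.pos_of_ne_zero h
    · push Not at hs
      obtain ⟨i, hi⟩ := hs
      obtain ⟨n, u, hu, hlt⟩ := ih i (ht.1 i) hi
      refine ⟨n, u, hu, ?_⟩
      rw [numShuffles, numShuffles, if_neg hm]
      -- If the outer shuffle has become an atom itself, its count drops to zero.
      split_ifs
      · omega
      · refine Nat.add_lt_add_left (Finset.sum_lt_sum (fun j _ => ?_) ⟨i, Finset.mem_univ _, hlt⟩) 1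
        exact numShuffles_anti (subset_insert _ _) _

theorem same_of_rep {X : Type} [LinearOrder X] {𝒜 : Set Term.Class} {col : X → Term.Class}
    {I : Set X} {S T : Term} (hS : S.IsNormalForm) (hT : T.IsNormalForm) (h : Rep 𝒜 col S I)
    (h' : Rep 𝒜 col T I) : S.Same T := by
  induction hk : numShuffles 𝒜 S using Nat.strong_induction_on generalizing 𝒜 col I with
  | _ k ih =>
    by_cases h0 : numShuffles 𝒜 S = 0
    · have hI := h.finite h0
      exact Term.cls_eq.1 ((h.cls_eq_of_finite hI).trans (h'.cls_eq_of_finite hI).symm)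
    -- The shuffle is chosen from `S` alone, but `R` and `col'` refer to no term, so the same
    -- collapse applies to `T`.
    · obtain ⟨n, u, hu, hlt⟩ := exists_innermost hS h0
      obtain ⟨R, col', hR⟩ := exists_collapses h u
      exact ih _ (hk ▸ hlt) (h.collapse hu hS hR) (h'.collapse hu hT hR) rfl

/-! ### The represented orders -/

theorem Rep.image {X Y : Type} [LinearOrder X] [LinearOrder Y] {f : X → Y} (hf : StrictMono f)
    {a : Term.Class} {t : Term} {I : Set X} (h : Rep ∅ (fun _ => a) t I) :
    Rep ∅ (fun _ => a) t (f '' I) := by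
  have hb : ∀ {J K : Set X}, Before J K → Before (f '' J) (f '' K) := by
    rintro J K h _ ⟨x, hx, rfl⟩ _ ⟨y, hy, rfl⟩
    exact hf (h x hx y hy)
  induction t generalizing I with
  | one =>
    obtain ⟨x, rfl, hx⟩ := h
    exact ⟨f x, image_singleton, hx⟩
  | cat s t hs ht =>
    obtain ⟨J, K, hJ, hK, hJK, rfl⟩ := h
    exact ⟨f '' J, f '' K, hs hJ, ht hK, hb hJK, image_union _ _ _⟩
  | shuffle s ih =>
    rw [rep_shuffle_of_notMem (notMem_empty _)] at h ⊢
    obtain ⟨ι, _, c, B, hB⟩ := h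
    exact ⟨ι, _, c, fun i => f '' B i, hB.nonempty, hB.noMin, hB.noMax, hB.dense,
      fun i j hij => hb (hB.before i j hij), by rw [hB.eq, image_iUnion],
      fun i => ih _ (hB.prop i)⟩

/-- The starting point of the induction: no shuffle is an atom yet, and all points have the colour
of the singleton. -/
theorem rep_univ (t : Term) : Rep (X := t.L) ∅ (fun _ => Term.one.cls) t univ := by
  induction t with
  | one => exact ⟨(), by ext; simp; rfl, rfl⟩
  | cat s t hs ht =>
    refine ⟨_, _, hs.image (Y := (Term.cat s t).L) (f := fun x => toLex (Sum.inl x)) ?_,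
      ht.image (Y := (Term.cat s t).L) (f := fun x => toLex (Sum.inr x)) ?_, ?_, ?_⟩
    · exact fun x y h => Sum.Lex.inl_lt_inl_iff.2 h
    · exact fun x y h => Sum.Lex.inr_lt_inr_iff.2 h
    · rintro _ ⟨x, -, rfl⟩ _ ⟨y, -, rfl⟩
      exact Sum.Lex.inl_lt_inr x y
    · refine (eq_univ_of_forall fun x => ?_).symm
      rcases x with x | x
      · exact Or.inl ⟨x, trivial, rfl⟩
      · exact Or.inr ⟨x, trivial, rfl⟩
  | @shuffle n t ih =>
    rw [rep_shuffle_of_notMem (notMem_empty _)]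
    have hcol := colour_isGenericColouring n
    refine ⟨ℚ, inferInstance, colour n,
      fun q => (fun x : (t (colour n q)).L => (⟨q, x⟩ : (Term.shuffle t).L)) '' univ,
      inferInstance, exists_lt, exists_gt, hcol.interdense, ?_, ?_, ?_⟩
    · rintro p q hpq _ ⟨x, -, rfl⟩ _ ⟨y, -, rfl⟩
      exact Sigma.Lex.left _ _ hpq
    · refine (eq_univ_of_forall fun x => ?_).symm
      obtain ⟨q, x⟩ := x
      exact mem_iUnion.2 ⟨q, x, trivial, rfl⟩
    · exact fun q => (ih (colour n q)).image fun x y h => Sigma.Lex.right _ _ h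

end CatOrder

theorem mainTheorem1 (S T : CatOrder.Term) (hS : S.IsNormalForm) (hT : T.IsNormalForm)
    (h : Nonempty (S.L ≃o T.L)) : S.Same T := by
  obtain ⟨f⟩ := h
  have h' := (CatOrder.rep_univ S).image f.strictMono
  rw [Set.image_univ, f.range_eq] at h'
  exact CatOrder.same_of_rep hS hT h' (CatOrder.rep_univ T)
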